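/- Let $\Bbbk$ be a field and $R=\Bbbk[x_1,\dots,x_n]$. For an ideal $J\subseteq R$, let $\overline J$ denote its integral closure, i.e. the ideal of all $x\in R$ satisfying an equation $x^m+a_1x^{m-1}+\dots+a_m=0$ with $m\ge 1$ and $a_i\in J^i$. For a rational number $u=p/q>0$ (with $p,q$ positive integers), let $$\overline{J^{u}}=\{x\in R \mid x^q\in\overline{J^p}\}$$ be the $u$-th rational power of $J$ (an ideal which does not depend on the presentation $u=p/q$), and let $$\overline{J^{(u)}}=\bigcap_{\mathfrak p\in\mathrm{Ass}(R/J)}\left(\overline{J^{u}}R_{\mathfrak p}\cap R\right)$$ be its $u$-th rational symbolic power; the empty intersection is $R$. **Theorem.** Let $u\in\mathbb Q_{>0}$. 1. If $I\subseteq R$ is a squarefree monomial ideal, i.e. an ideal generated by squarefree monomials, then $$\overline{I^{(u)}}=\bigcap_{\mathfrak p\in\mathrm{Ass}(R/I)}\overline{\mathfrak p^{u}}.$$ 2. If $\mathfrak p\subseteq R$ is a monomial prime, i.e. an ideal generated by a subset of the variables, then $\overline{\mathfrak p^{(u)}}=\overline{\mathfrak p^{u}}$. -/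

import Mathlib

namespace RationalPowers

section Closure

variable {R : Type*} [CommRing R]

/-- `x` is integral over the ideal `I`: there is an equation
`x ^ n + a₁ x ^ (n - 1) + ⋯ + aₙ = 0` with `n ≥ 1` and `aᵢ ∈ I ^ i`. -/
def IsIntegralOver (I : Ideal R) (x : R) : Prop :=
  ∃ n : ℕ, 0 < n ∧ ∃ a : ℕ → R,
    (∀ i ∈ Finset.Icc 1 n, a i ∈ I ^ i) ∧
      x ^ n + ∑ i ∈ Finset.Icc 1 n, a i * x ^ (n - i) = 0

/-- Integrality over a power of an ideal, through the Rees algebra. -/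
theorem isIntegralOver_pow_iff (I : Ideal R) (k : ℕ) (x : R) :
    IsIntegralOver (I ^ k) x ↔
      IsIntegral (reesAlgebra I) (Polynomial.monomial k x) := by
  constructor
  · rintro ⟨n, hn, a, ha, h⟩
    let b : ℕ → reesAlgebra I := fun i =>
      if hi : i ∈ Finset.Icc 1 n then
        ⟨Polynomial.monomial (k * i) (a i), reesAlgebra.monomial_mem.mpr (by
          rw [pow_mul]; exact ha i hi)⟩
      else 0
    refine ⟨Polynomial.X ^ n +
      ∑ i ∈ Finset.Icc 1 n, Polynomial.C (b i) * Polynomial.X ^ (n - i), ?_, ?_⟩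
    · apply Polynomial.monic_X_pow_add
      refine lt_of_le_of_lt (Polynomial.degree_sum_le _ _) ?_
      rw [Finset.sup_lt_iff (by exact WithBot.bot_lt_coe n)]
      intro i hi
      refine lt_of_le_of_lt (Polynomial.degree_C_mul_X_pow_le _ _) ?_
      have := Finset.mem_Icc.mp hi
      exact_mod_cast (by omega : n - i < n)
    · have key : ∀ i ∈ Finset.Icc 1 n,
          (algebraMap (reesAlgebra I) (Polynomial R)) (b i) *
            (Polynomial.monomial k x) ^ (n - i) =
          Polynomial.monomial (k * n) (a i * x ^ (n - i)) := by
        intro i hi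
        have h1 : (algebraMap (reesAlgebra I) (Polynomial R)) (b i) =
            Polynomial.monomial (k * i) (a i) := by
          simp only [b, dif_pos hi]; rfl
        have := Finset.mem_Icc.mp hi
        rw [h1, Polynomial.monomial_pow, Polynomial.monomial_mul_monomial, ← mul_add]
        rw [Nat.add_sub_cancel' this.2]
      simp only [Polynomial.eval₂_add, Polynomial.eval₂_pow, Polynomial.eval₂_X,
        Polynomial.eval₂_finsetSum, Polynomial.eval₂_mul, Polynomial.eval₂_C]
      rw [Finset.sum_congr rfl key, Polynomial.monomial_pow, ← map_sum, ← map_add, h, map_zero]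
  · rintro ⟨f, hf, h⟩
    rcases subsingleton_or_nontrivial R with hR | hR
    · exact ⟨1, one_pos, 0, fun i _ => by simp, Subsingleton.elim _ _⟩
    have hd : 0 < f.natDegree := by
      rw [pos_iff_ne_zero]
      intro h0
      rw [hf.natDegree_eq_zero.mp h0, Polynomial.eval₂_one] at h
      exact one_ne_zero h
    refine ⟨f.natDegree, hd,
      fun i => ((f.coeff (f.natDegree - i) : reesAlgebra I) : Polynomial R).coeff (k * i), ?_, ?_⟩
    · intro i _
      rw [← pow_mul]
      exact (f.coeff (f.natDegree - i)).2 (k * i)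
    · have h2 := congrArg (fun g : Polynomial R => g.coeff (k * f.natDegree)) h
      simp only [Polynomial.coeff_zero] at h2
      rw [Polynomial.eval₂_eq_sum_range, Polynomial.finsetSum_coeff,
        Finset.sum_range_succ, ← Finset.sum_range_reflect] at h2
      rw [← h2, add_comm]
      congr 1
      · refine Finset.sum_bij' (fun i _ => i - 1) (fun i _ => i + 1) ?_ ?_ ?_ ?_ ?_
        · intro i hi; simp only [Finset.mem_Icc, Finset.mem_range] at *; omega
        · intro i hi; simp only [Finset.mem_Icc, Finset.mem_range] at *; omega
        · intro i hi; simp only [Finset.mem_Icc] at *; omega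
        · intro i hi; simp
        · intro i hi
          simp only [Finset.mem_Icc] at hi
          have e1 : f.natDegree - 1 - (i - 1) = f.natDegree - i := by omega
          have e2 : k * f.natDegree = k * i + k * (f.natDegree - i) := by
            rw [← mul_add]; congr 1; omega
          rw [e1, Polynomial.monomial_pow, e2]
          exact (Polynomial.coeff_mul_monomial _ _ _ _).symm
      · rw [hf.coeff_natDegree, map_one, one_mul, Polynomial.monomial_pow,
          Polynomial.coeff_monomial, if_pos rfl]

/-- The integral closure of an ideal, as an ideal. -/
def idealClosure (I : Ideal R) : Ideal R where
  carrier := {x | IsIntegralOver I x}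
  zero_mem' := ⟨1, one_pos, 0, fun i _ => by simp, by simp⟩
  add_mem' := by
    intro x y hx hy
    simp only [Set.mem_ofPred_eq] at *
    rw [← pow_one I, isIntegralOver_pow_iff] at *
    rw [map_add]
    exact hx.add hy
  smul_mem' := by
    intro c x hx
    simp only [Set.mem_ofPred_eq] at *
    rw [← pow_one I, isIntegralOver_pow_iff] at *
    have : Polynomial.monomial 1 (c • x) =
        algebraMap (reesAlgebra I) (Polynomial R) (algebraMap R (reesAlgebra I) c) *
          Polynomial.monomial 1 x := by
      rw [← IsScalarTower.algebraMap_apply, Polynomial.algebraMap_eq,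
        Polynomial.C_mul_monomial, smul_eq_mul]
    rw [this]
    exact isIntegral_algebraMap.mul hx

theorem mem_idealClosure {I : Ideal R} {x : R} :
    x ∈ idealClosure I ↔ IsIntegralOver I x := Iff.rfl

theorem mem_idealClosure_pow_iff {I : Ideal R} {k : ℕ} {x : R} :
    x ∈ idealClosure (I ^ k) ↔
      IsIntegral (reesAlgebra I) (Polynomial.monomial k x) :=
  isIntegralOver_pow_iff I k x

/-- For a rational number `u = p / q` (in lowest terms, `q > 0`, and `p ≥ 0`), the `u`-th rational
power of `I`, that is, the ideal of all `x` such that `x ^ q` lies in the integral closure of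
`I ^ p`. See `mem_rationalPower_iff` for the independence of the presentation of `u`. -/
def rationalPower (I : Ideal R) (u : ℚ) : Ideal R where
  carrier := {x | x ^ u.den ∈ idealClosure (I ^ u.num.toNat)}
  zero_mem' := by
    simp only [Set.mem_ofPred_eq]
    rw [zero_pow u.den_nz]
    exact zero_mem _
  add_mem' := by
    intro x y hx hy
    simp only [Set.mem_ofPred_eq] at *
    rw [add_pow]
    refine Ideal.sum_mem _ fun i hi => Ideal.mul_mem_right _ _ ?_
    have hi' : i ≤ u.den := by
      have := Finset.mem_range.mp hi
      omega
    rw [mem_idealClosure_pow_iff] at *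
    refine IsIntegral.of_pow u.den_pos ?_
    have : (Polynomial.monomial u.num.toNat (x ^ i * y ^ (u.den - i))) ^ u.den =
        (Polynomial.monomial u.num.toNat (x ^ u.den)) ^ i *
          (Polynomial.monomial u.num.toNat (y ^ u.den)) ^ (u.den - i) := by
      simp only [Polynomial.monomial_pow, Polynomial.monomial_mul_monomial]
      rw [← mul_add, Nat.add_sub_cancel' hi', mul_pow, ← pow_mul, ← pow_mul, ← pow_mul,
        ← pow_mul, mul_comm i, mul_comm (u.den - i)]
    rw [this]
    exact (hx.pow _).mul (hy.pow _)
  smul_mem' := by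
    intro c x hx
    simp only [Set.mem_ofPred_eq] at *
    rw [smul_eq_mul, mul_pow]
    exact Ideal.mul_mem_left _ _ hx

/-- Membership in a rational power can be tested with any presentation `u = p / q`. -/
theorem mem_rationalPower_iff (I : Ideal R) {u : ℚ} {p q : ℕ} (hq : 0 < q)
    (hu : u = (p : ℚ) / q) (x : R) :
    x ∈ rationalPower I u ↔ x ^ q ∈ idealClosure (I ^ p) := by
  have scale : ∀ (k m : ℕ) (y : R), 0 < m →
      (y ^ m ∈ idealClosure (I ^ (k * m)) ↔ y ∈ idealClosure (I ^ k)) := by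
    intro k m y hm
    rw [mem_idealClosure_pow_iff, mem_idealClosure_pow_iff, ← Polynomial.monomial_pow]
    exact ⟨fun h => IsIntegral.of_pow hm h, fun h => h.pow m⟩
  have h0 : 0 ≤ u.num := by
    rw [Rat.num_nonneg, hu]; positivity
  have hcross : u.num.toNat * q = p * u.den := by
    have h1 : (u.num : ℚ) * q = p * u.den := by
      have h2 : (u.num : ℚ) / u.den = (p : ℚ) / q := by rw [Rat.num_div_den, hu]
      have hq' : (q : ℚ) ≠ 0 := by exact_mod_cast hq.ne'
      have hd' : (u.den : ℚ) ≠ 0 := by exact_mod_cast u.den_nz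
      exact (div_eq_div_iff hd' hq').mp h2
    have h3 : u.num * (q : ℤ) = p * u.den := by exact_mod_cast h1
    zify
    rw [Int.toNat_of_nonneg h0]
    exact h3
  change x ^ u.den ∈ idealClosure (I ^ u.num.toNat) ↔ _
  rw [← scale u.num.toNat q _ hq, ← scale p u.den _ u.den_pos, hcross, ← pow_mul, ← pow_mul,
    mul_comm q u.den]

/-- The `u`-th rational symbolic power of `I`: the intersection, over the associated primes `P`
of `R ⧸ I`, of the contractions to `R` of the extension of the `u`-th rational power of `I` to the
localization of `R` at `P`. -/
noncomputable def rationalSymbolicPower (I : Ideal R) (u : ℚ) : Ideal R :=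
  ⨅ (P : Ideal R) (hP : P ∈ associatedPrimes R (R ⧸ I)),
    haveI : P.IsPrime := hP.isPrime
    ((rationalPower I u).map (algebraMap R (Localization.AtPrime P))).comap
      (algebraMap R (Localization.AtPrime P))

end Closure

section Monomial

variable {k : Type*} [Field k] {n : ℕ}

/-- An ideal of `k[x₁, …, xₙ]` generated by a set of squarefree monomials `∏ i ∈ s, xᵢ`. -/
def IsSquarefreeMonomialIdeal (I : Ideal (MvPolynomial (Fin n) k)) : Prop :=
  ∃ S : Set (Finset (Fin n)),
    I = Ideal.span ((fun s : Finset (Fin n) => ∏ i ∈ s, (MvPolynomial.X i)) '' S)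

/-- An ideal of `k[x₁, …, xₙ]` generated by a subset of the variables. -/
def IsMonomialPrime (P : Ideal (MvPolynomial (Fin n) k)) : Prop :=
  ∃ s : Set (Fin n), P = Ideal.span (MvPolynomial.X '' s)

end Monomial

end RationalPowers

namespace RationalPowers

/-! ### Integral closure and rational powers under multiplication and ring maps. -/

section Integral

variable {R : Type*} [CommRing R]

/-! Let `P` be associated to `R ⧸ I`, say `P = (I : x)`. Since `I` is radical, `x ∉ P`; so `x * P ⊆
I ⊆ P` and `I`, `P` agree locally at `P`. It also follows that `P` is generated by variables
(`IsSquarefreeMonomialIdeal.exists_of_mem_associatedPrimes`). A power of `x` then carries a rational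
power of `P` into that of `I` (`pow_mul_mem_rationalPower`), so the two have the same extension to
the localization. Contraction adds nothing to the rational power of `P`, which is `P`-primary
(`mem_rationalPower_of_mul_mem`): `gradingHom` turns the `P`-adic order into the order in one prime
element `X`, where integral closure of powers and cancellation are clear. -/

theorem IsIntegralOver.mono {I J : Ideal R} (h : I ≤ J) {x : R} (hx : IsIntegralOver I x) :
    IsIntegralOver J x := by
  obtain ⟨n, hn, a, ha, e⟩ := hx
  exact ⟨n, hn, a, fun i hi => Ideal.pow_right_mono h i (ha i hi), e⟩

theorem mem_rationalPower {I : Ideal R} {u : ℚ} {x : R} :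
    x ∈ rationalPower I u ↔ x ^ u.den ∈ idealClosure (I ^ u.num.toNat) := Iff.rfl

theorem rationalPower_mono {I J : Ideal R} (h : I ≤ J) (u : ℚ) :
    rationalPower I u ≤ rationalPower J u :=
  fun _ hx => IsIntegralOver.mono (Ideal.pow_right_mono h _) hx

theorem mul_pow_mem_pow_of_forall_mul_mem {I J : Ideal R} {s : R} (h : ∀ y ∈ J, s * y ∈ I)
    (i : ℕ) : ∀ y ∈ J ^ i, s ^ i * y ∈ I ^ i := by
  induction i with
  | zero => simp
  | succ i ih =>
    intro y hy
    rw [pow_succ J] at hy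
    induction hy using Submodule.mul_induction_on' with
    | mem_mul_mem b hb c hc =>
      have := Ideal.mul_mem_mul (ih b hb) (h c hc)
      rw [← pow_succ] at this
      rwa [show s ^ (i + 1) * (b * c) = s ^ i * b * (s * c) by ring]
    | add b _ c _ hb hc =>
      rw [mul_add]
      exact add_mem hb hc

/-- If `s J ⊆ I` and `x` is integral over `J`, then `s x` is integral over `I`. -/
theorem IsIntegralOver.mul_left {I J : Ideal R} {s x : R} (h : ∀ y ∈ J, s * y ∈ I)
    (hx : IsIntegralOver J x) : IsIntegralOver I (s * x) := by
  obtain ⟨n, hn, a, ha, e⟩ := hx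
  refine ⟨n, hn, fun i => s ^ i * a i,
    fun i hi => mul_pow_mem_pow_of_forall_mul_mem h i _ (ha i hi), ?_⟩
  have key : ∀ i ∈ Finset.Icc 1 n,
      s ^ i * a i * (s * x) ^ (n - i) = s ^ n * (a i * x ^ (n - i)) := by
    intro i hi
    have hin := (Finset.mem_Icc.mp hi).2
    have : s ^ n = s ^ i * s ^ (n - i) := by rw [← pow_add, Nat.add_sub_cancel' hin]
    rw [this, mul_pow]
    ring
  rw [Finset.sum_congr rfl key, ← Finset.mul_sum, mul_pow, ← mul_add, e, mul_zero]

/-- If `s J ⊆ I`, then a power of `s` multiplies the rational power of `J` into that of `I`. -/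
theorem pow_mul_mem_rationalPower {I J : Ideal R} {s x : R} {u : ℚ} (h : ∀ y ∈ J, s * y ∈ I)
    (hx : x ∈ rationalPower J u) : s ^ u.num.toNat * x ∈ rationalPower I u := by
  rw [mem_rationalPower] at hx ⊢
  have h1 : s ^ u.num.toNat * x ^ u.den ∈ idealClosure (I ^ u.num.toNat) :=
    IsIntegralOver.mul_left (mul_pow_mem_pow_of_forall_mul_mem h _) hx
  -- One of the `u.den` factors `s ^ u.num.toNat` already gives integrality; the other `d` are
  -- absorbed by the ideal.
  obtain ⟨d, hd⟩ := Nat.exists_eq_succ_of_ne_zero u.den_nz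
  have h2 : (s ^ u.num.toNat * x) ^ u.den =
      (s ^ u.num.toNat) ^ d * (s ^ u.num.toNat * x ^ u.den) := by
    rw [hd, mul_pow, pow_succ (s ^ u.num.toNat)]
    ring
  rw [h2]
  exact Ideal.mul_mem_left _ _ h1

/-- Powers of a principal prime ideal in a Noetherian domain are integrally closed. -/
theorem pow_dvd_of_isIntegralOver [IsDomain R] [IsNoetherianRing R] {t y : R} (ht : Prime t)
    {p : ℕ} (hy : IsIntegralOver (Ideal.span {t ^ p}) y) : t ^ p ∣ y := by
  obtain ⟨n, hn, a, ha, e⟩ := hy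
  rcases eq_or_ne y 0 with rfl | hy0
  · exact dvd_zero _
  obtain ⟨z, hz, hzt⟩ :=
    (FiniteMultiplicity.of_not_isUnit ht.not_isUnit hy0).exists_eq_pow_mul_and_not_dvd
  set m := multiplicity t y
  by_cases hpm : p ≤ m
  · exact hz ▸ (pow_dvd_pow t hpm).mul_right z
  exfalso
  -- If `m < p`, each term has order at least `p * i + m * (n - i) > m * n`, because `i ≥ 1`; but `y
  -- ^ n` has order exactly `m * n`.
  have hsum : t ^ (m * n + 1) ∣ ∑ i ∈ Finset.Icc 1 n, a i * y ^ (n - i) := by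
    refine Finset.dvd_sum fun i hi => ?_
    have h1 : t ^ (p * i) ∣ a i := by
      have := ha i hi
      rwa [Ideal.span_singleton_pow, Ideal.mem_span_singleton, ← pow_mul] at this
    have h2 : t ^ (m * (n - i)) ∣ y ^ (n - i) := by
      rw [hz, mul_pow, ← pow_mul]
      exact dvd_mul_right _ _
    refine dvd_trans ?_ (mul_dvd_mul h1 h2)
    rw [← pow_add]
    apply pow_dvd_pow
    obtain ⟨hi1, hin⟩ := Finset.mem_Icc.mp hi
    have h3 : m * n = m * i + m * (n - i) := by rw [← mul_add, Nat.add_sub_cancel' hin]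
    have h4 : (m + 1) * i ≤ p * i := Nat.mul_le_mul_right i (by omega)
    rw [add_mul] at h4
    omega
  have h5 : t ^ (m * n + 1) ∣ y ^ n := by
    rw [eq_neg_of_add_eq_zero_left e]
    exact hsum.neg_right
  rw [hz, mul_pow, ← pow_mul, pow_succ] at h5
  exact hzt (ht.dvd_of_dvd_pow ((mul_dvd_mul_iff_left (pow_ne_zero _ ht.ne_zero)).mp h5))

theorem IsIntegralOver.map {S : Type*} [CommRing S] (f : R →+* S) {I : Ideal R} {x : R}
    (hx : IsIntegralOver I x) : IsIntegralOver (I.map f) (f x) := by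
  obtain ⟨n, hn, a, ha, e⟩ := hx
  refine ⟨n, hn, fun i => f (a i), fun i hi => ?_, ?_⟩
  · rw [← Ideal.map_pow]
    exact Ideal.mem_map_of_mem f (ha i hi)
  · simpa using congrArg f e

end Integral

/-! ### Ideals generated by variables. -/

section VariableIdeal

variable {k : Type*} [Field k] {σ : Type*}

open Classical in
/-- The homomorphism sending `xᵢ` to `xᵢ t` for `i ∈ T` and fixing the other variables. -/
noncomputable def gradingHom (k : Type*) [Field k] (T : Set σ) :
    MvPolynomial σ k →ₐ[k] Polynomial (MvPolynomial σ k) :=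
  MvPolynomial.aeval fun i =>
    if i ∈ T then Polynomial.monomial 1 (MvPolynomial.X i) else Polynomial.C (MvPolynomial.X i)

theorem gradingHom_mem_reesAlgebra (T : Set σ) (f : MvPolynomial σ k) :
    gradingHom k T f ∈ reesAlgebra (Ideal.span (MvPolynomial.X '' T : Set (MvPolynomial σ k))) := by
  induction f using MvPolynomial.induction_on with
  | C a =>
    rw [gradingHom, MvPolynomial.aeval_C]
    exact Subalgebra.algebraMap_mem (reesAlgebra _) (MvPolynomial.C a)
  | add f g hf hg => rw [map_add]; exact add_mem hf hg
  | mul_X f i hf =>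
    rw [map_mul]
    refine mul_mem hf ?_
    rw [gradingHom, MvPolynomial.aeval_X]
    split_ifs with hi
    · rw [reesAlgebra.monomial_mem, pow_one]
      exact Ideal.subset_span ⟨i, hi, rfl⟩
    · exact Subalgebra.algebraMap_mem (reesAlgebra _) (MvPolynomial.X i)

theorem eval_one_gradingHom (T : Set σ) (f : MvPolynomial σ k) :
    (gradingHom k T f).eval 1 = f := by
  induction f using MvPolynomial.induction_on with
  | C a =>
    rw [gradingHom, MvPolynomial.aeval_C]
    exact Polynomial.eval_C (a := MvPolynomial.C a)
  | add f g hf hg => rw [map_add, Polynomial.eval_add, hf, hg]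
  | mul_X f i hf =>
    rw [map_mul, Polynomial.eval_mul, hf, gradingHom, MvPolynomial.aeval_X]
    split_ifs <;> simp

theorem map_gradingHom_span_le (T : Set σ) :
    (Ideal.span (MvPolynomial.X '' T : Set (MvPolynomial σ k))).map
      (gradingHom k T : MvPolynomial σ k →+* Polynomial (MvPolynomial σ k)) ≤
      Ideal.span {Polynomial.X} := by
  rw [Ideal.map_span, Ideal.span_le]
  rintro _ ⟨_, ⟨i, hi, rfl⟩, rfl⟩
  rw [SetLike.mem_coe, Ideal.mem_span_singleton, RingHom.coe_coe, gradingHom,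
    MvPolynomial.aeval_X, if_pos hi, ← Polynomial.C_mul_X_eq_monomial]
  exact dvd_mul_left _ _

/-- Setting `X = 1` writes `f` as the sum of the coefficients of its image, and the `i`-th one lies
in the `i`-th power of the ideal. Conversely, the generators map to multiples of `X`. -/
theorem X_pow_dvd_gradingHom_iff (T : Set σ) (p : ℕ) (f : MvPolynomial σ k) :
    Polynomial.X ^ p ∣ gradingHom k T f ↔
      f ∈ Ideal.span (MvPolynomial.X '' T : Set (MvPolynomial σ k)) ^ p := by
  constructor
  · intro h
    rw [Polynomial.X_pow_dvd_iff] at h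
    rw [← eval_one_gradingHom T f, Polynomial.eval_eq_sum_range]
    refine Ideal.sum_mem _ fun i _ => ?_
    rw [one_pow, mul_one]
    rcases lt_or_ge i p with hi | hi
    · rw [h i hi]
      exact zero_mem _
    · exact Ideal.pow_le_pow_right hi (gradingHom_mem_reesAlgebra T f i)
  · intro h
    rw [← Ideal.mem_span_singleton, ← Ideal.span_singleton_pow]
    have := Ideal.mem_map_of_mem
      (gradingHom k T : MvPolynomial σ k →+* Polynomial (MvPolynomial σ k)) h
    rw [Ideal.map_pow] at this
    exact Ideal.pow_right_mono (map_gradingHom_span_le T) p this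

theorem X_dvd_gradingHom_iff (T : Set σ) (f : MvPolynomial σ k) :
    Polynomial.X ∣ gradingHom k T f ↔
      f ∈ Ideal.span (MvPolynomial.X '' T : Set (MvPolynomial σ k)) := by
  simpa using X_pow_dvd_gradingHom_iff T 1 f

theorem isPrime_span_X_image (T : Set σ) :
    (Ideal.span (MvPolynomial.X '' T : Set (MvPolynomial σ k))).IsPrime := by
  refine ⟨fun h => ?_, fun {f g} h => ?_⟩
  · rw [Ideal.eq_top_iff_one, ← X_dvd_gradingHom_iff, map_one] at h
    exact Polynomial.prime_X.not_isUnit (isUnit_of_dvd_one h)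
  · rw [← X_dvd_gradingHom_iff, map_mul] at h
    simpa only [X_dvd_gradingHom_iff] using Polynomial.prime_X.dvd_or_dvd h

variable [Finite σ]

/-- Each power is the preimage of the same power of the principal prime `(X)`, which is integrally
closed. -/
theorem idealClosure_span_X_image_pow (T : Set σ) (p : ℕ) :
    idealClosure (Ideal.span (MvPolynomial.X '' T : Set (MvPolynomial σ k)) ^ p) =
      Ideal.span (MvPolynomial.X '' T : Set (MvPolynomial σ k)) ^ p := by
  apply le_antisymm
  · intro f hf
    rw [← X_pow_dvd_gradingHom_iff]
    refine pow_dvd_of_isIntegralOver Polynomial.prime_X (IsIntegralOver.mono ?_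
      (IsIntegralOver.map (gradingHom k T : MvPolynomial σ k →+* Polynomial (MvPolynomial σ k)) hf))
    rw [Ideal.map_pow, ← Ideal.span_singleton_pow]
    exact Ideal.pow_right_mono (map_gradingHom_span_le T) p
  · intro f hf
    exact ⟨1, one_pos, fun _ => -f, by simpa using hf, by simp⟩

/-- Rational powers of an ideal `P` generated by variables are `P`-primary. -/
theorem mem_rationalPower_of_mul_mem {T : Set σ} {s f : MvPolynomial σ k} {u : ℚ}
    (hs : s ∉ Ideal.span (MvPolynomial.X '' T : Set (MvPolynomial σ k)))
    (h : s * f ∈ rationalPower (Ideal.span (MvPolynomial.X '' T : Set (MvPolynomial σ k))) u) :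
    f ∈ rationalPower (Ideal.span (MvPolynomial.X '' T : Set (MvPolynomial σ k))) u := by
  rw [mem_rationalPower, idealClosure_span_X_image_pow, ← X_pow_dvd_gradingHom_iff] at h ⊢
  rw [mul_pow, map_mul] at h
  refine Polynomial.prime_X.pow_dvd_of_dvd_mul_left _ (fun hd => hs ?_) h
  rw [map_pow] at hd
  exact (X_dvd_gradingHom_iff T s).mp (Polynomial.prime_X.dvd_of_dvd_pow hd)

end VariableIdeal

/-! ### Squarefree monomial ideals and their associated primes. -/

section Squarefree

variable {k : Type*} [Field k] {n : ℕ}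

theorem mem_span_squarefree_iff {S : Set (Finset (Fin n))} {f : MvPolynomial (Fin n) k} :
    f ∈ Ideal.span ((fun s : Finset (Fin n) => ∏ i ∈ s, (MvPolynomial.X i)) '' S :
        Set (MvPolynomial (Fin n) k)) ↔
      ∀ m ∈ f.support, ∃ s ∈ S, s ⊆ m.support := by
  have h1 : ((fun s : Finset (Fin n) => ∏ i ∈ s, (MvPolynomial.X i)) '' S :
      Set (MvPolynomial (Fin n) k)) = (fun m => MvPolynomial.monomial m (1 : k)) ''
        ((fun s : Finset (Fin n) => ∑ i ∈ s, Finsupp.single i 1) '' S) := by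
    rw [Set.image_image]
    refine Set.image_congr fun s _ => ?_
    exact (MvPolynomial.monomial_sum_one s _).symm
  rw [h1, MvPolynomial.mem_ideal_span_monomial_image]
  refine forall₂_congr fun m _ => ?_
  rw [Set.exists_mem_image]
  refine exists_congr fun s => and_congr_right fun _ => ?_
  rw [Finsupp.le_def]
  have h2 : ∀ i, (∑ j ∈ s, Finsupp.single j 1 : Fin n →₀ ℕ) i = if i ∈ s then 1 else 0 := by
    intro i
    simp [Finsupp.finsetSum_apply, Finsupp.single_apply]
  constructor
  · intro h i hi
    have := h i
    rw [h2, if_pos hi] at this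
    rw [Finsupp.mem_support_iff]
    omega
  · intro h i
    rw [h2]
    split_ifs with hi
    · exact Nat.one_le_iff_ne_zero.mpr (Finsupp.mem_support_iff.mp (h hi))
    · exact Nat.zero_le _

theorem span_squarefree_le_of_isPrime {S : Set (Finset (Fin n))}
    {P : Ideal (MvPolynomial (Fin n) k)} [hP : P.IsPrime]
    (h : Ideal.span ((fun s : Finset (Fin n) => ∏ i ∈ s, MvPolynomial.X i) '' S) ≤ P) :
    Ideal.span ((fun s : Finset (Fin n) => ∏ i ∈ s, (MvPolynomial.X i : MvPolynomial (Fin n) k)) ''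
        S) ≤
      Ideal.span (MvPolynomial.X '' {i : Fin n | MvPolynomial.X i ∈ P}) := by
  rw [Ideal.span_le]
  rintro _ ⟨s, hs, rfl⟩
  obtain ⟨i, hi, hiP⟩ := hP.prod_mem_iff.mp (h (Ideal.subset_span ⟨s, hs, rfl⟩))
  exact Ideal.mem_of_dvd _ (Finset.dvd_prod_of_mem _ hi) (Ideal.subset_span ⟨i, hiP, rfl⟩)

/-- Squarefree monomial ideals are radical. -/
theorem IsSquarefreeMonomialIdeal.isRadical {I : Ideal (MvPolynomial (Fin n) k)}
    (hI : IsSquarefreeMonomialIdeal I) : I.IsRadical := by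
  obtain ⟨S, rfl⟩ := hI
  rintro f ⟨N, hf⟩
  rw [mem_span_squarefree_iff]
  intro m hm
  by_contra! hcon
  -- The variables absent from `m` generate a prime containing `I` but not `f`, since `m` occurs in
  -- `f`.
  have hle : Ideal.span ((fun s : Finset (Fin n) => ∏ i ∈ s, (MvPolynomial.X i)) '' S) ≤
      Ideal.span (MvPolynomial.X '' {i : Fin n | m i = 0} : Set (MvPolynomial (Fin n) k)) := by
    rw [Ideal.span_le]
    rintro _ ⟨s, hs, rfl⟩
    obtain ⟨i, hi, him⟩ := Finset.not_subset.mp (hcon s hs)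
    exact Ideal.mem_of_dvd _ (Finset.dvd_prod_of_mem _ hi)
      (Ideal.subset_span ⟨i, Finsupp.notMem_support_iff.mp him, rfl⟩)
  have hmem := (isPrime_span_X_image {i : Fin n | m i = 0}).mem_of_pow_mem N (hle hf)
  obtain ⟨i, hi, hi'⟩ := MvPolynomial.mem_ideal_span_X_image.mp hmem m hm
  exact hi' hi

/-- An associated prime `P` of a squarefree monomial ideal `I` is generated by variables, and `I`
and `P` agree locally at `P`. -/
theorem IsSquarefreeMonomialIdeal.exists_of_mem_associatedPrimes
    {I P : Ideal (MvPolynomial (Fin n) k)} (hI : IsSquarefreeMonomialIdeal I)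
    (hP : P ∈ associatedPrimes (MvPolynomial (Fin n) k) (MvPolynomial (Fin n) k ⧸ I)) :
    I ≤ P ∧ (∃ T : Set (Fin n), P = Ideal.span (MvPolynomial.X '' T)) ∧
      ∃ s ∉ P, ∀ y ∈ P, s * y ∈ I := by
  have hPprime : P.IsPrime := hP.isPrime
  obtain ⟨-, x, hx⟩ := Submodule.isAssociatedPrime_iff.mp hP
  obtain ⟨x, rfl⟩ := Ideal.Quotient.mk_surjective x
  have hmem : ∀ y, y ∈ P ↔ x * y ∈ I := by
    intro y
    rw [hx, Submodule.mem_colon_singleton, Submodule.mem_bot, mul_comm x,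
      ← Ideal.Quotient.eq_zero_iff_mem, map_mul]
    rfl
  have hIP : I ≤ P := fun y hy => (hmem y).mpr (I.mul_mem_left x hy)
  have hxP : x ∉ P := by
    intro h
    have h2 := (hmem x).mp h
    rw [← pow_two] at h2
    have hxI : x ∈ I := hI.isRadical ⟨2, h2⟩
    refine hPprime.ne_top ((Ideal.eq_top_iff_one P).mpr ((hmem 1).mpr ?_))
    rwa [mul_one]
  refine ⟨hIP, ⟨{i | MvPolynomial.X i ∈ P}, le_antisymm ?_ ?_⟩, x, hxP, fun y => (hmem y).mp⟩
  · obtain ⟨S, rfl⟩ := hI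
    intro y hy
    -- The variables in `P` generate a prime that contains `x * y` but not `x`, hence contains `y`.
    have hle := span_squarefree_le_of_isPrime hIP
    refine ((isPrime_span_X_image _).mem_or_mem (hle ((hmem y).mp hy))).resolve_left
      fun h => hxP ?_
    refine Ideal.span_le.mpr ?_ h
    rintro _ ⟨i, hi, rfl⟩
    exact hi
  · rw [Ideal.span_le]
    rintro _ ⟨i, hi, rfl⟩
    exact hi

theorem IsSquarefreeMonomialIdeal.rationalSymbolicPower_eq {I : Ideal (MvPolynomial (Fin n) k)}
    (hI : IsSquarefreeMonomialIdeal I) (u : ℚ) :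
    rationalSymbolicPower I u =
      ⨅ P ∈ associatedPrimes (MvPolynomial (Fin n) k) (MvPolynomial (Fin n) k ⧸ I),
        rationalPower P u := by
  refine iInf_congr fun P => iInf_congr fun hP => ?_
  have : P.IsPrime := hP.isPrime
  obtain ⟨hIP, ⟨T, hT⟩, s, hs, hsI⟩ := hI.exists_of_mem_associatedPrimes hP
  ext f
  rw [Ideal.mem_comap, IsLocalization.algebraMap_mem_map_algebraMap_iff P.primeCompl]
  constructor
  · rintro ⟨r, hr, hrf⟩
    have h := rationalPower_mono hIP u hrf
    have hr' : r ∉ P := hr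
    rw [hT] at h hr' ⊢
    exact mem_rationalPower_of_mul_mem hr' h
  · intro hf
    exact ⟨s ^ u.num.toNat, P.primeCompl.pow_mem hs _, pow_mul_mem_rationalPower hsI hf⟩

theorem IsMonomialPrime.isSquarefreeMonomialIdeal {P : Ideal (MvPolynomial (Fin n) k)}
    (hP : IsMonomialPrime P) : IsSquarefreeMonomialIdeal P := by
  obtain ⟨T, rfl⟩ := hP
  refine ⟨(fun i => {i}) '' T, ?_⟩
  simp [Set.image_image]

end Squarefree

end RationalPowers

theorem mainTheorem10 {k : Type*} [Field k] {n : ℕ} (u : ℚ) (hu : 0 < u) :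
    (∀ I : Ideal (MvPolynomial (Fin n) k), RationalPowers.IsSquarefreeMonomialIdeal I →
      RationalPowers.rationalSymbolicPower I u =
        ⨅ P ∈ associatedPrimes (MvPolynomial (Fin n) k) (MvPolynomial (Fin n) k ⧸ I),
          RationalPowers.rationalPower P u) ∧
    (∀ P : Ideal (MvPolynomial (Fin n) k), RationalPowers.IsMonomialPrime P →
      RationalPowers.rationalSymbolicPower P u = RationalPowers.rationalPower P u) := by
  refine ⟨fun I hI => hI.rationalSymbolicPower_eq u, fun P hP => ?_⟩
  have hprime : P.IsPrime := by
    obtain ⟨T, rfl⟩ := hP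
    exact RationalPowers.isPrime_span_X_image T
  rw [hP.isSquarefreeMonomialIdeal.rationalSymbolicPower_eq u,
    associatedPrimes.eq_singleton_of_isPrimary hprime.isPrimary, hprime.radical, iInf_singleton]
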